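/- Let $X=\{x_1,\dots,x_n\}\subset\mathbb{R}^d$ consist of $n<\infty$ distinct points, let $\Omega\subseteq\mathbb{R}^D$ be closed and non-empty, and let $\varphi\in C_0(X\times\Omega)$ be a real continuous function vanishing at infinity. Let $y:X\to\mathbb{R}$, $y_i=y(x_i)$, let $\gamma_1,\dots,\gamma_n>0$ with $\sum_i\gamma_i=1$, and put $\nu=\sum_{i=1}^n\gamma_i\delta_{x_i}$. Let $\mathcal M(\Omega)$, $\mathcal M(X)$ be the spaces of signed Radon measures (finite, with the total variation norm), and write $(A\mu)(x)=\int_\Omega\varphi(x,w)\,d\mu(w)$, $(A^*\rho)(w)=\int_X\varphi(x,w)\,d\rho(x)$ and $\mathcal F(X,\Omega)=\{A\mu:\mu\in\mathcal M(\Omega)\}$. Put $$J(f)=\tfrac12\int_X (f-y)^2\,d\nu,\quad R(\mu)=|\mu|(\Omega),\quad J^*(\rho)=\sup_{f\in\mathcal F(X,\Omega)}\Big(\int_X f\,d\rho-J(f)\Big),\quad R^*(g)=\sup_{\mu\in\mathcal M(\Omega)}\Big(\int_\Omega g\,d\mu-R(\mu)\Big).$$ The empirical risk minimisation (ERM) problem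 is $\inf_{\mu\in\mathcal M(\Omega)}J(A\mu)+R(\mu)$ and its dual is $\sup_{\rho\in\mathcal M(X)}-J^*(-\rho)-R^*(A^*\rho)$. For $\alpha,\lambda\in\mathbb{R}^n$ and $\mathbf w\in\Omega^n$ put $$J(\alpha,\mathbf w)=\tfrac12\sum_{i=1}^n\gamma_i\Big(\sum_{j=1}^n\alpha_j\varphi(x_i,w_j)-y_i\Big)^2,\qquad R(\alpha)=\|\alpha\|_1,$$ $$J^*(\lambda)=\sum_{i=1}^n\lambda_i\Big(\frac{\lambda_i}{2\gamma_i}+y_i\Big),\qquad R^*(\lambda)=\begin{cases}0&\text{if }-1\le\sum_{i=1}^n\lambda_i\varphi(x_i,w)\le1\text{ for all }w\in\Omega,\\ \infty&\text{otherwise.}\end{cases}$$ Then: 1. (Primal.) For $\mu_{\alpha,\mathbf w}=\sum_{j=1}^n\alpha_j\delta_{w_j}$ one has $J(A\mu_{\alpha,\mathbf w})=J(\alpha,\mathbf w)$ and $R(\mu_{\alpha,\mathbf w})\le R(\alpha)$, with equality if the $w_j$ are distinct. Moreover $$\inf_{\mu\in\mathcal M(\Omega)}J(A\mu)+R(\mu)=\inf_{\alpha\in\mathbb{R}^n,\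 \mathbf w\in\Omega^n}J(\alpha,\mathbf w)+R(\alpha),$$ and if $(\alpha,\mathbf w)$ minimises the right-hand side, then $\mu_{\alpha,\mathbf w}$ minimises the left-hand side. 2. (Dual.) Every $\rho\in\mathcal M(X)$ is $\rho_\lambda=\sum_{i=1}^n\lambda_i\delta_{x_i}$ for a unique $\lambda\in\mathbb{R}^n$. One has $R^*(A^*\rho_\lambda)=R^*(\lambda)$ for every $\lambda$ and, if $\mathcal F(X,\Omega)$ is dense in $L^2(\nu)$, also $J^*(\rho_\lambda)=J^*(\lambda)$ for every $\lambda$. Whether or not $\mathcal F(X,\Omega)$ is dense, $$\sup_{\rho\in\mathcal M(X)}-J^*(-\rho)-R^*(A^*\rho)=\sup_{\lambda\in\mathbb{R}^n}-J^*(-\lambda)-R^*(\lambda).$$ 3. (Strong duality.) $$\inf_{\alpha\in\mathbb{R}^n,\ \mathbf w\in\Omega^n}J(\alpha,\mathbf w)+R(\alpha)=\sup_{\lambda\in\mathbb{R}^n}-J^*(-\lambda)-R^*(\lambda).$$ -/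

import Mathlib

open MeasureTheory
open scoped ZeroAtInfty

noncomputable section

namespace IntegralRKBS

variable {X Ω : Type*} [TopologicalSpace X] [TopologicalSpace Ω]
  [MeasurableSpace X] [MeasurableSpace Ω]

/-- The total variation norm `|μ|(S)` of a finite signed measure, `|μ| = μ⁺ + μ⁻` being given by
the Jordan decomposition. On a closed subset of a Euclidean space every finite signed Borel
measure is regular, so that `SignedMeasure S` is there the space of signed Radon measures. -/
def tvNorm {S : Type*} [MeasurableSpace S] (μ : SignedMeasure S) : ℝ :=
  (μ.totalVariation Set.univ).toReal

/-- The pairing `⟨μ, f⟩ = ∫ f dμ` of a signed measure and a real function. -/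
def pairing {S : Type*} [MeasurableSpace S] (μ : SignedMeasure S) (f : S → ℝ) : ℝ :=
  VectorMeasure.integral μ f (ContinuousLinearMap.lsmul ℝ ℝ)

/-- `(A μ)(x) = ∫ φ(x, w) dμ(w)`. -/
def featureMap (φ : C₀(X × Ω, ℝ)) (μ : SignedMeasure Ω) : X → ℝ :=
  fun x => pairing μ (fun w => φ (x, w))

/-- `(A* ρ)(w) = ∫ φ(x, w) dρ(x)`. -/
def adjointMap (φ : C₀(X × Ω, ℝ)) (ρ : SignedMeasure X) : Ω → ℝ :=
  fun w => pairing ρ (fun x => φ (x, w))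

/-- The functions on `X` that belong to the integral reproducing kernel Banach space. -/
def functionSpace (φ : C₀(X × Ω, ℝ)) : Set (X → ℝ) :=
  Set.range (featureMap φ)

/-- The function space is dense in `L²(ν)`. -/
def DenseInL2 (φ : C₀(X × Ω, ℝ)) (ν : Measure X) : Prop :=
  Dense {h : Lp ℝ 2 ν | ∃ f ∈ functionSpace φ, (h : X → ℝ) =ᵐ[ν] f}

/-- The data fidelity term `J(f) = ½ ‖f - y‖²` in `L²(ν)`. -/
def fidelity (ν : Measure X) (y : X → ℝ) (f : X → ℝ) : ℝ :=
  1 / 2 * ∫ x, (f x - y x) ^ 2 ∂ν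

/-- The objective `J(A μ) + R(μ)` of the empirical risk minimisation problem,
with `R(μ) = |μ|(Ω)`. -/
def ermObjective (φ : C₀(X × Ω, ℝ)) (ν : Measure X) (y : X → ℝ) (μ : SignedMeasure Ω) : ℝ :=
  fidelity ν y (featureMap φ μ) + tvNorm μ

/-- `J*(ρ) = sup_f (⟨ρ, f⟩ - J(f))`, over the functions `f = A μ`. -/
def fidelityConj (φ : C₀(X × Ω, ℝ)) (ν : Measure X) (y : X → ℝ) (ρ : SignedMeasure X) : EReal :=
  ⨆ f ∈ functionSpace φ, ((pairing ρ f - fidelity ν y f : ℝ) : EReal)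

/-- `R*(g) = sup_μ (⟨μ, g⟩ - R(μ))`, over the finite signed measures `μ` on `Ω`. -/
def regConj (g : Ω → ℝ) : EReal :=
  ⨆ μ : SignedMeasure Ω, ((pairing μ g - tvNorm μ : ℝ) : EReal)

/-- The value `inf_μ J(A μ) + R(μ)` of the primal problem. -/
def primalValue (φ : C₀(X × Ω, ℝ)) (ν : Measure X) (y : X → ℝ) : EReal :=
  ⨅ μ : SignedMeasure Ω, (ermObjective φ ν y μ : EReal)

/-- The value `sup_ρ - J*(-ρ) - R*(A* ρ)` of the dual problem. -/
def dualValue (φ : C₀(X × Ω, ℝ)) (ν : Measure X) (y : X → ℝ) : EReal :=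
  ⨆ ρ : SignedMeasure X, (-fidelityConj φ ν y (-ρ) - regConj (adjointMap φ ρ))

/-- The measure `∑ i, c i • δ_{s i}`. -/
def atomic {n : ℕ} {S : Type*} [MeasurableSpace S] (c : Fin n → ℝ) (s : Fin n → S) :
    SignedMeasure S :=
  ∑ i, VectorMeasure.dirac (s i) (c i)

/-- The data distribution `∑ i, γ i • δ_{x i}` for nonnegative weights `γ`. -/
def dataMeasure {n : ℕ} (γ : Fin n → ℝ) (x : Fin n → X) : Measure X :=
  ∑ i, ENNReal.ofReal (γ i) • Measure.dirac (x i)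

/-- `J(α, w) = ½ ∑ i, γ i (∑ j, α j φ(x i, w j) - y i)²`. -/
def finFidelity {n : ℕ} (φ : C₀(X × Ω, ℝ)) (x : Fin n → X) (γ : Fin n → ℝ) (y : X → ℝ)
    (α : Fin n → ℝ) (w : Fin n → Ω) : ℝ :=
  1 / 2 * ∑ i, γ i * (∑ j, α j * φ (x i, w j) - y (x i)) ^ 2

/-- The `ℓ¹` norm `∑ j, |α j|`. -/
def l1Norm {n : ℕ} (α : Fin n → ℝ) : ℝ :=
  ∑ j, |α j|

/-- `J(α, w) + ‖α‖₁`. -/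
def finObjective {n : ℕ} (φ : C₀(X × Ω, ℝ)) (x : Fin n → X) (γ : Fin n → ℝ) (y : X → ℝ)
    (p : (Fin n → ℝ) × (Fin n → Ω)) : ℝ :=
  finFidelity φ x γ y p.1 p.2 + l1Norm p.1

/-- `J*(l) = ∑ i, l i (l i / (2 γ i) + y i)`. -/
def finFidelityConj {n : ℕ} (x : Fin n → X) (γ : Fin n → ℝ) (y : X → ℝ) (l : Fin n → ℝ) : ℝ :=
  ∑ i, l i * (l i / (2 * γ i) + y (x i))

open Classical in
/-- `R*(l) = 0` if `-1 ≤ ∑ i, l i φ(x i, w) ≤ 1` for all `w`, and `R*(l) = ∞` otherwise. -/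
def finRegConj {n : ℕ} (φ : C₀(X × Ω, ℝ)) (x : Fin n → X) (l : Fin n → ℝ) : EReal :=
  if ∀ w : Ω, -1 ≤ ∑ i, l i * φ (x i, w) ∧ ∑ i, l i * φ (x i, w) ≤ 1 then 0 else ⊤

end IntegralRKBS

end

set_option linter.unusedSectionVars false

/-! The four values form a cycle: measure primal ≤ finite primal ≤ finite dual ≤ measure dual ≤
measure primal, so all are equal. Three links are soft. Atomic measures are competitors in the
primal; the conjugate over `functionSpace φ` is at most the conjugate over all functions, so density
is not needed for the values; weak duality is Fenchel–Young applied twice. The remaining link is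
`exists_dual_certificate`. The closed convex cone generated by the pairs (prediction, `ℓ¹` bound)
contains a minimiser of the coercive objective. First-order optimality there makes the weighted
residual a feasible dual point with the same value. Nearby points of the cone are finite
combinations of features, and a Carathéodory argument that does not increase the `ℓ¹` norm
(`exists_card_support_le`) cuts them down to `n` atoms. -/

namespace IntegralRKBS

/-! ### Signed measures, atoms and the conjugate of the total variation norm -/

section Measures

variable {S : Type*} [MeasurableSpace S]

theorem tvNorm_eq_variation (μ : SignedMeasure S) : tvNorm μ = μ.variation.real Set.univ := by
  rw [tvNorm, SignedMeasure.totalVariation_eq_variation, Measure.real]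

theorem isFiniteMeasure_variation (μ : SignedMeasure S) : IsFiniteMeasure μ.variation := by
  rw [← SignedMeasure.totalVariation_eq_variation]; infer_instance

theorem tvNorm_zero : tvNorm (0 : SignedMeasure S) = 0 := by
  simp [tvNorm_eq_variation]

theorem pairing_le_tvNorm (μ : SignedMeasure S) {f : S → ℝ} (hf : ∀ s, |f s| ≤ 1) :
    pairing μ f ≤ tvNorm μ := by
  have := isFiniteMeasure_variation μ
  have h := VectorMeasure.norm_integral_le_of_norm_le_const (μ := μ) (f := f)
    (B := ContinuousLinearMap.lsmul ℝ ℝ) (C := 1) (Filter.Eventually.of_forall hf)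
  rw [tvNorm_eq_variation]
  refine (le_abs_self _).trans (h.trans ?_)
  simp

theorem integrable_of_continuous_bounded [TopologicalSpace S] [OpensMeasurableSpace S]
    (μ : SignedMeasure S) {f : S → ℝ} (hf : Continuous f) {C : ℝ} (hC : ∀ s, |f s| ≤ C) :
    μ.Integrable f := by
  have := isFiniteMeasure_variation μ
  exact Integrable.of_bound hf.measurable.aestronglyMeasurable C (Filter.Eventually.of_forall hC)

theorem pairing_finsetSum {ι : Type*} (t : Finset ι) (μ : SignedMeasure S) {c : ι → ℝ}
    {f : ι → S → ℝ} (hf : ∀ i ∈ t, μ.Integrable (f i)) :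
    pairing μ (fun s => ∑ i ∈ t, c i * f i s) = ∑ i ∈ t, c i * pairing μ (f i) := by
  have h := VectorMeasure.integral_finsetSum (μ := μ) (B := ContinuousLinearMap.lsmul ℝ ℝ) t
    (f := fun i s => c i * f i s) (fun i hi => (hf i hi).const_mul (c i))
  rw [pairing]
  rw [h]
  refine Finset.sum_congr rfl fun i _ => ?_
  exact VectorMeasure.integral_fun_smul (μ := μ) (B := ContinuousLinearMap.lsmul ℝ ℝ) (c i) (f i)

theorem pairing_neg (μ : SignedMeasure S) (f : S → ℝ) : pairing (-μ) f = -pairing μ f :=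
  VectorMeasure.integral_neg_vectorMeasure

theorem pairing_zero (f : S → ℝ) : pairing (0 : SignedMeasure S) f = 0 :=
  VectorMeasure.integral_zero_vectorMeasure

theorem neg_atomic {n : ℕ} (c : Fin n → ℝ) (s : Fin n → S) : -atomic c s = atomic (-c) s := by
  rw [atomic, atomic, ← Finset.sum_neg_distrib]
  refine Finset.sum_congr rfl fun i _ => ?_
  ext t ht
  by_cases h : s i ∈ t
  · simp [h, ht]
  · simp [h]

theorem tvNorm_dirac (s : S) (c : ℝ) :
    tvNorm (VectorMeasure.dirac s c : SignedMeasure S) = |c| := by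
  simp [tvNorm_eq_variation, Measure.real]

/-- Subadditivity of the variation; coinciding atoms may cancel, so equality can fail. -/
theorem tvNorm_atomic_le {n : ℕ} (c : Fin n → ℝ) (s : Fin n → S) :
    tvNorm (atomic c s) ≤ l1Norm c := by
  rw [tvNorm_eq_variation, Measure.real]
  have h := VectorMeasure.variation_finsetSum_le Finset.univ
    (fun i => (VectorMeasure.dirac (s i) (c i) : SignedMeasure S)) Set.univ
  have e : (∑ i, (VectorMeasure.dirac (s i) (c i) : SignedMeasure S).variation) Set.univ
      = ENNReal.ofReal (l1Norm c) := by
    simp only [l1Norm, VectorMeasure.variation_dirac, Measure.coe_finsetSum, Finset.sum_apply]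
    rw [ENNReal.ofReal_sum_of_nonneg fun i _ => abs_nonneg _]
    exact Finset.sum_congr rfl fun i _ => by simp [Real.enorm_eq_ofReal_abs]
  rw [e] at h
  exact ENNReal.toReal_le_of_le_ofReal (Finset.sum_nonneg fun i _ => abs_nonneg _) h

theorem regConj_eq_zero {g : S → ℝ} (hg : ∀ s, |g s| ≤ 1) : regConj g = 0 := by
  refine le_antisymm (iSup_le fun μ => ?_) (le_iSup_of_le 0 ?_)
  · exact_mod_cast sub_nonpos.2 (pairing_le_tvNorm μ hg)
  · simp [pairing_zero, tvNorm_zero]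

variable [MeasurableSingletonClass S]

theorem pairing_dirac (s : S) (c : ℝ) (f : S → ℝ) :
    pairing (VectorMeasure.dirac s c) f = c * f s := by
  rw [pairing, VectorMeasure.integral_dirac]
  simp [mul_comm]

theorem integrable_dirac (s : S) (c : ℝ) (f : S → ℝ) :
    (VectorMeasure.dirac s c : SignedMeasure S).Integrable f := by
  rw [VectorMeasure.Integrable, VectorMeasure.variation_dirac]
  exact (MeasureTheory.integrable_dirac (by simp)).smul_measure (by simp)

theorem pairing_atomic {n : ℕ} (c : Fin n → ℝ) (s : Fin n → S) (f : S → ℝ) :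
    pairing (atomic c s) f = ∑ i, c i * f (s i) := by
  have h := VectorMeasure.integral_finsetSum_vectorMeasure (B := ContinuousLinearMap.lsmul ℝ ℝ)
    (μ := fun i => (VectorMeasure.dirac (s i) (c i) : SignedMeasure S)) (s := Finset.univ) (f := f)
    fun i _ => integrable_dirac (s i) (c i) f
  rw [pairing, atomic, h]
  exact Finset.sum_congr rfl fun i _ => pairing_dirac (s i) (c i) f

theorem atomic_apply_singleton {n : ℕ} (c : Fin n → ℝ) {s : Fin n → S}
    (hs : Function.Injective s) (j : Fin n) : atomic c s {s j} = c j := by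
  rw [atomic, FunLike.coe_sum, Finset.sum_apply, Finset.sum_eq_single j]
  · exact VectorMeasure.dirac_apply_of_mem (measurableSet_singleton _) rfl
  · intro i _ hij
    exact VectorMeasure.dirac_apply_of_notMem fun h => hij (hs h)
  · simp

theorem tvNorm_atomic {n : ℕ} (c : Fin n → ℝ) {s : Fin n → S} (hs : Function.Injective s) :
    tvNorm (atomic c s) = l1Norm c := by
  refine le_antisymm (tvNorm_atomic_le c s) ?_
  have := isFiniteMeasure_variation (atomic c s)
  rw [tvNorm_eq_variation, l1Norm]
  calc ∑ j, |c j| ≤ ∑ j, (atomic c s).variation.real {s j} := by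
        refine Finset.sum_le_sum fun j _ => ?_
        have h := VectorMeasure.norm_measure_le_variation (μ := atomic c s) (E := {s j})
        rwa [atomic_apply_singleton c hs, Real.norm_eq_abs] at h
    _ = (atomic c s).variation.real (⋃ j ∈ Finset.univ, {s j}) := by
        rw [measureReal_biUnion_finset]
        · intro i _ j _ hij
          simpa using fun h => hij (hs h)
        · exact fun j _ => measurableSet_singleton _
    _ ≤ _ := measureReal_mono (Set.subset_univ _)

theorem existsUnique_eq_atomic {n : ℕ} (x : Fin n ≃ S) (ρ : SignedMeasure S) :
    ∃! l : Fin n → ℝ, ρ = atomic l x := by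
  refine ⟨fun i => ρ {x i}, ?_, ?_⟩
  · classical
    have : Finite S := Finite.of_equiv _ x
    ext t ht
    have e : t = ⋃ i ∈ Finset.univ.filter (fun i => x i ∈ t), {x i} := by
      ext s
      simp only [Finset.mem_filter, Finset.mem_univ, true_and, Set.mem_iUnion,
        Set.mem_singleton_iff, exists_prop]
      exact ⟨fun h => ⟨x.symm s, by simpa using h, by simp⟩, by rintro ⟨i, hi, rfl⟩; exact hi⟩
    have hsum : ∀ μ : SignedMeasure S,
        μ t = ∑ i ∈ Finset.univ.filter (fun i => x i ∈ t), μ {x i} := by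
      intro μ
      conv_lhs => rw [e]
      refine VectorMeasure.of_biUnion_finset ?_ fun i _ => measurableSet_singleton _
      intro i _ j _ hij
      simpa using hij
    rw [hsum ρ, hsum (atomic _ _)]
    exact Finset.sum_congr rfl fun i _ => (atomic_apply_singleton (fun i => ρ {x i}) x.injective i).symm
  · rintro l rfl
    funext i
    exact (atomic_apply_singleton l x.injective i).symm

theorem fidelity_dataMeasure {n : ℕ} {γ : Fin n → ℝ} (hγ : ∀ i, 0 ≤ γ i) (x : Fin n → S)
    (y f : S → ℝ) :
    fidelity (dataMeasure γ x) y f = 1 / 2 * ∑ i, γ i * (f (x i) - y (x i)) ^ 2 := by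
  rw [fidelity, dataMeasure, integral_finsetSum_measure]
  · congr 1
    refine Finset.sum_congr rfl fun i _ => ?_
    rw [integral_smul_measure, integral_dirac, ENNReal.toReal_ofReal (hγ i), smul_eq_mul]
  · exact fun i _ => (MeasureTheory.integrable_dirac (by simp)).smul_measure (by simp)

theorem regConj_eq_top {g : S → ℝ} {s : S} (hs : 1 < |g s|) : regConj g = ⊤ := by
  refine EReal.eq_top_iff_forall_lt _ |>.2 fun r => ?_
  have h0 : 0 < |g s| - 1 := sub_pos.2 hs
  -- A Dirac mass of size `c`, with the sign of `g s`, gains at least `c * (|g s| - 1) = |r| + 1`,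
  -- which exceeds `r`.
  set c : ℝ := (|r| + 1) / (|g s| - 1)
  have hc : 0 ≤ c := by positivity
  have hcr : c * (|g s| - 1) = |r| + 1 := div_mul_cancel₀ _ h0.ne'
  refine lt_of_lt_of_le ?_ (le_iSup _ (VectorMeasure.dirac s (c * SignType.sign (g s))))
  rw [pairing_dirac, tvNorm_dirac, EReal.coe_lt_coe_iff]
  have hsg : (SignType.sign (g s) : ℝ) * g s = |g s| := sign_mul_self _
  have hsa : |(SignType.sign (g s) : ℝ)| ≤ 1 := by
    rcases lt_trichotomy (g s) 0 with h | h | h <;> simp [h]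
  have h1 : |c * (SignType.sign (g s) : ℝ)| ≤ c := by
    rw [abs_mul, abs_of_nonneg hc]; exact mul_le_of_le_one_right hc hsa
  have h2 : c * (SignType.sign (g s) : ℝ) * g s = c * |g s| := by rw [mul_assoc, hsg]
  rw [h2]
  nlinarith [le_abs_self r]

end Measures

/-! ### Carathéodory reduction of the number of atoms -/

section AtomReduction

variable {S V : Type*} [AddCommGroup V] [Module ℝ V]

/-- The `ℓ¹` norm of a finitely supported function. -/
def finsuppL1 (a : S →₀ ℝ) : ℝ :=
  ∑ s ∈ a.support, |a s|

theorem finsuppL1_nonneg (a : S →₀ ℝ) : 0 ≤ finsuppL1 a :=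
  Finset.sum_nonneg fun _ _ => abs_nonneg _

theorem finsuppL1_eq_sum_of_subset {a : S →₀ ℝ} {t : Finset S} (h : a.support ⊆ t) :
    finsuppL1 a = ∑ s ∈ t, |a s| :=
  Finset.sum_subset h fun s _ hs => by simpa using hs

theorem finsuppL1_add_le (a b : S →₀ ℝ) : finsuppL1 (a + b) ≤ finsuppL1 a + finsuppL1 b := by
  classical
  rw [finsuppL1_eq_sum_of_subset (Finsupp.support_add (g₁ := a) (g₂ := b)),
    finsuppL1_eq_sum_of_subset (Finset.subset_union_left (s₁ := a.support) (s₂ := b.support)),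
    finsuppL1_eq_sum_of_subset (Finset.subset_union_right (s₁ := a.support) (s₂ := b.support)),
    ← Finset.sum_add_distrib]
  exact Finset.sum_le_sum fun s _ => abs_add_le _ _

theorem finsuppL1_smul {c : ℝ} (hc : 0 ≤ c) (a : S →₀ ℝ) :
    finsuppL1 (c • a) = c * finsuppL1 a := by
  rw [finsuppL1_eq_sum_of_subset (Finsupp.support_smul (b := c) (g := a)), finsuppL1,
    Finset.mul_sum]
  exact Finset.sum_congr rfl fun s _ => by simp [abs_mul, abs_of_nonneg hc]

theorem finsuppL1_single (s : S) (c : ℝ) : finsuppL1 (Finsupp.single s c) = |c| := by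
  rw [finsuppL1_eq_sum_of_subset (Finsupp.support_single_subset (a := s) (b := c))]
  simp

/-- A linear relation between the atoms allows to remove one of them without increasing the
`ℓ¹` norm of the coefficients. -/
theorem exists_support_ssubset [FiniteDimensional ℝ V] (v : S → V) (a : S →₀ ℝ)
    (ha : Module.finrank ℝ V < a.support.card) :
    ∃ b : S →₀ ℝ, b.support ⊂ a.support ∧
      Finsupp.linearCombination ℝ v b = Finsupp.linearCombination ℝ v a ∧
      finsuppL1 b ≤ finsuppL1 a := by
  classical
  -- A linear relation may be negated; its sign is chosen so that subtracting a positive multiple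
  -- does not increase the `ℓ¹` norm to first order.
  obtain ⟨c, hcs, hc0, hcv, hcpos⟩ : ∃ c : S →₀ ℝ, c.support ⊆ a.support ∧ c ≠ 0 ∧
      Finsupp.linearCombination ℝ v c = 0 ∧ 0 ≤ ∑ s ∈ a.support, SignType.sign (a s) * c s := by
    have hdep : ¬ LinearIndepOn ℝ v (a.support : Set S) := fun h => by
      have := LinearIndependent.fintype_card_le_finrank h
      simp at this
      omega
    rw [linearIndepOn_iff] at hdep
    push Not at hdep
    obtain ⟨c, hc, hcv, hc0⟩ := hdep
    have hcs : c.support ⊆ a.support := by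
      exact_mod_cast (Finsupp.mem_supported ℝ c).1 hc
    rcases le_total 0 (∑ s ∈ a.support, SignType.sign (a s) * c s) with h | h
    · exact ⟨c, hcs, hc0, hcv, h⟩
    · refine ⟨-c, by simpa using hcs, neg_ne_zero.2 hc0, by simp [hcv], ?_⟩
      simpa using h
  have hsupp : ∀ s, s ∉ a.support → c s = 0 := fun s hs =>
    Finsupp.notMem_support_iff.1 fun h => hs (hcs h)
  -- The coefficients that move towards zero when a positive multiple of `c` is subtracted. If there
  -- were none, all terms of the nonnegative sum would be nonpositive, forcing `c = 0`.
  set T := a.support.filter fun s => 0 < a s * c s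
  have hT : T.Nonempty := by
    by_contra hne
    have hle : ∀ s ∈ a.support, (SignType.sign (a s) : ℝ) * c s ≤ 0 := by
      intro s hs
      by_contra hlt
      refine hne ⟨s, Finset.mem_filter.2 ⟨hs, ?_⟩⟩
      have h1 := mul_pos (abs_pos.2 (Finsupp.mem_support_iff.1 hs)) (not_le.1 hlt)
      rwa [← mul_assoc, mul_comm |a s|, sign_mul_abs] at h1
    have hz := (Finset.sum_eq_zero_iff_of_nonpos hle).1
      (le_antisymm (Finset.sum_nonpos hle) hcpos)
    refine hc0 (Finsupp.ext fun s => ?_)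
    by_cases hs : s ∈ a.support
    · have hsa : (SignType.sign (a s) : ℝ) ≠ 0 := by
        rcases lt_or_gt_of_ne (Finsupp.mem_support_iff.1 hs) with h | h <;> simp [h]
      simpa [hsa] using hz s hs
    · exact hsupp s hs
  -- The least ratio belongs to a coefficient that vanishes first. Up to that time no coefficient
  -- changes sign, so every absolute value is affine in the step length.
  obtain ⟨s₀, hs₀, hmin⟩ := T.exists_min_image (fun s => a s / c s) hT
  obtain ⟨hs₀a, hs₀p⟩ := Finset.mem_filter.1 hs₀
  have hc₀ : c s₀ ≠ 0 := right_ne_zero_of_mul hs₀p.ne'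
  have hratio : ∀ s, 0 < a s * c s → 0 < a s / c s := fun s h => by
    have := div_pos h (pow_pos (abs_pos.2 (right_ne_zero_of_mul h.ne')) 2)
    rw [sq_abs, sq] at this
    rwa [mul_div_mul_right _ _ (right_ne_zero_of_mul h.ne')] at this
  set t := a s₀ / c s₀
  have ht : 0 < t := hratio s₀ hs₀p
  have habs : ∀ s ∈ a.support,
      |(a - t • c) s| = |a s| - t * (SignType.sign (a s) * c s) := by
    intro s hs
    have hle : 0 < a s * c s → t ≤ a s / c s := fun h => hmin s (Finset.mem_filter.2 ⟨hs, h⟩)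
    simp only [Finsupp.coe_sub, Finsupp.coe_smul, Pi.sub_apply, Pi.smul_apply, smul_eq_mul]
    rcases lt_or_gt_of_ne (Finsupp.mem_support_iff.1 hs) with h | h
    · have : a s - t * c s ≤ 0 := by
        rcases le_or_gt 0 (c s) with h' | h'
        · nlinarith [mul_nonneg ht.le h']
        · have := (le_div_iff_of_neg h').1 (hle (mul_pos_of_neg_of_neg h h'))
          linarith
      rw [abs_of_nonpos this, abs_of_neg h, sign_neg h]
      simp; ring
    · have : 0 ≤ a s - t * c s := by
        rcases le_or_gt (c s) 0 with h' | h'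
        · nlinarith [mul_nonneg ht.le (neg_nonneg.2 h')]
        · have := (le_div_iff₀ h').1 (hle (mul_pos h h'))
          linarith
      rw [abs_of_nonneg this, abs_of_pos h, sign_pos h]
      simp
  have hsub : (a - t • c).support ⊆ a.support := by
    intro s hs
    by_contra h
    have h' : a s = 0 := by simpa using h
    simp [hsupp s h, h'] at hs
  refine ⟨a - t • c, ⟨hsub, fun h => ?_⟩, by simp [hcv], ?_⟩
  · have := h hs₀a
    simp [t, div_mul_cancel₀ _ hc₀] at this
  · rw [finsuppL1_eq_sum_of_subset hsub, Finset.sum_congr rfl habs, Finset.sum_sub_distrib,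
      ← Finset.mul_sum, finsuppL1]
    linarith [mul_nonneg ht.le hcpos]

theorem exists_card_support_le [FiniteDimensional ℝ V] (v : S → V) (a : S →₀ ℝ) :
    ∃ b : S →₀ ℝ, b.support.card ≤ Module.finrank ℝ V ∧
      Finsupp.linearCombination ℝ v b = Finsupp.linearCombination ℝ v a ∧
      finsuppL1 b ≤ finsuppL1 a := by
  induction h : a.support.card using Nat.strong_induction_on generalizing a with
  | _ k ih =>
    by_cases hk : a.support.card ≤ Module.finrank ℝ V
    · exact ⟨a, hk, rfl, le_rfl⟩
    · obtain ⟨b, hb, hbv, hbl⟩ := exists_support_ssubset v a (not_le.1 hk)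
      obtain ⟨d, hd, hdv, hdl⟩ := ih _ (h ▸ Finset.card_lt_card hb) b rfl
      exact ⟨d, hd, hdv.trans hbv, hdl.trans hbl⟩

theorem exists_fin_combination [Nonempty S] {n : ℕ} (v : S → V) (a : S →₀ ℝ)
    (ha : a.support.card ≤ n) :
    ∃ (α : Fin n → ℝ) (w : Fin n → S), ∑ j, α j • v (w j) = Finsupp.linearCombination ℝ v a ∧
      l1Norm α = finsuppL1 a := by
  classical
  obtain ⟨e⟩ : Nonempty (a.support ↪ Fin n) :=
    Function.Embedding.nonempty_of_card_le (by simpa using ha)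
  -- Unused slots get coefficient `0` at an arbitrary point; this needs `S` nonempty.
  let s₀ : S := Classical.arbitrary S
  let w : Fin n → S := Function.extend e (fun s => (s : S)) fun _ => s₀
  let α : Fin n → ℝ := Function.extend e (fun s => a s) fun _ => 0
  have hw : ∀ s, w (e s) = s := e.injective.extend_apply _ _
  have hα : ∀ s, α (e s) = a s := e.injective.extend_apply _ _
  have hα0 : ∀ j, j ∉ Set.range e → α j = 0 := fun j hj =>
    Function.extend_apply' _ _ _ fun ⟨s, hs⟩ => hj ⟨s, hs⟩
  refine ⟨α, w, ?_, ?_⟩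
  · rw [Finsupp.linearCombination_apply, Finsupp.sum, ← Finset.sum_coe_sort a.support,
      ← Fintype.sum_of_injective e e.injective _ (fun j => α j • v (w j)) (fun j hj => by rw [hα0 j hj, zero_smul])
        fun s => rfl]
    exact Finset.sum_congr rfl fun s _ => by rw [hw, hα]
  · rw [l1Norm, finsuppL1, ← Finset.sum_coe_sort a.support,
      ← Fintype.sum_of_injective e e.injective _ (fun j => |α j|) (fun j hj => by rw [hα0 j hj, abs_zero])
        fun s => rfl]
    exact Finset.sum_congr rfl fun s _ => by rw [hα]

end AtomReduction

/-! ### Optimality over the closed cone of features -/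

section FiniteDuality

variable {S : Type*} {n : ℕ}

/-- The pairs `(f, t)` such that `f` is a finite combination of the features with coefficients of
`ℓ¹` norm at most `t`. -/
def featureCone (v : S → Fin n → ℝ) : Set ((Fin n → ℝ) × ℝ) :=
  {p | ∃ a : S →₀ ℝ, Finsupp.linearCombination ℝ v a = p.1 ∧ finsuppL1 a ≤ p.2}

theorem zero_mem_featureCone (v : S → Fin n → ℝ) : 0 ∈ featureCone v :=
  ⟨0, by simp, by simp [finsuppL1]⟩

theorem add_mem_closure_featureCone {v : S → Fin n → ℝ} {p q : (Fin n → ℝ) × ℝ}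
    (hp : p ∈ closure (featureCone v)) (hq : q ∈ closure (featureCone v)) :
    p + q ∈ closure (featureCone v) := by
  refine map_mem_closure₂ continuous_add hp hq ?_
  rintro p ⟨a, ha, hat⟩ q ⟨b, hb, hbt⟩
  exact ⟨a + b, by simp [ha, hb], (finsuppL1_add_le a b).trans (add_le_add hat hbt)⟩

theorem smul_mem_closure_featureCone {v : S → Fin n → ℝ} {c : ℝ} (hc : 0 ≤ c)
    {p : (Fin n → ℝ) × ℝ} (hp : p ∈ closure (featureCone v)) :
    c • p ∈ closure (featureCone v) := by
  refine map_mem_closure (continuous_const_smul c) hp ?_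
  rintro p ⟨a, ha, hat⟩
  refine ⟨c • a, by simp [ha], ?_⟩
  rw [finsuppL1_smul hc]
  exact mul_le_mul_of_nonneg_left hat hc

theorem snd_nonneg_of_mem_closure_featureCone {v : S → Fin n → ℝ} {p : (Fin n → ℝ) × ℝ}
    (hp : p ∈ closure (featureCone v)) : 0 ≤ p.2 := by
  have hcl : IsClosed {p : (Fin n → ℝ) × ℝ | 0 ≤ p.2} := isClosed_le continuous_const continuous_snd
  refine closure_minimal ?_ hcl hp
  rintro p ⟨a, -, hat⟩
  exact (finsuppL1_nonneg a).trans hat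

/-- The regularised least squares objective as a function of the predictions and of the
regularisation term. -/
noncomputable def coneObjective (γ y : Fin n → ℝ) (p : (Fin n → ℝ) × ℝ) : ℝ :=
  1 / 2 * ∑ i, γ i * (p.1 i - y i) ^ 2 + p.2

theorem continuous_coneObjective (γ y : Fin n → ℝ) : Continuous (coneObjective γ y) := by
  unfold coneObjective
  fun_prop

/-- The closure is taken because the cone itself need not be closed. Positive weights and a
nonnegative last coordinate confine the sublevel set of the value at `0` to a box, hence it is
compact. -/
theorem exists_isMinOn_closure_featureCone (v : S → Fin n → ℝ) {γ : Fin n → ℝ}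
    (hγ : ∀ i, 0 < γ i) (y : Fin n → ℝ) :
    ∃ p ∈ closure (featureCone v), ∀ q ∈ closure (featureCone v),
      coneObjective γ y p ≤ coneObjective γ y q := by
  set K := closure (featureCone v)
  set M := coneObjective γ y 0
  have h0 : (0 : (Fin n → ℝ) × ℝ) ∈ K := subset_closure (zero_mem_featureCone v)
  have hcomp : IsCompact (K ∩ {p | coneObjective γ y p ≤ M}) := by
    let r : Fin n → ℝ := fun i => Real.sqrt (2 * M / γ i)
    refine IsCompact.of_isClosed_subset (isCompact_Icc (a := (y - r, (0 : ℝ))) (b := (y + r, M)))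
      (isClosed_closure.inter (isClosed_le (continuous_coneObjective γ y) continuous_const)) ?_
    rintro p ⟨hp, hpM : _ ≤ M⟩
    have h2 := snd_nonneg_of_mem_closure_featureCone hp
    have hterm : ∀ i, 0 ≤ γ i * (p.1 i - y i) ^ 2 := fun i =>
      mul_nonneg (hγ i).le (sq_nonneg _)
    have hsum := Finset.sum_nonneg fun i (_ : i ∈ Finset.univ) => hterm i
    rw [coneObjective] at hpM
    have habs : ∀ i, |p.1 i - y i| ≤ r i := by
      intro i
      refine Real.abs_le_sqrt ?_
      have := Finset.single_le_sum (fun j _ => hterm j) (Finset.mem_univ i)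
      rw [le_div_iff₀ (hγ i)]
      linarith
    refine ⟨⟨fun i => ?_, h2⟩, ⟨fun i => ?_, ?_⟩⟩
    · have := (abs_le.1 (habs i)).1
      simp only [Pi.sub_apply]; linarith
    · have := (abs_le.1 (habs i)).2
      simp only [Pi.add_apply]; linarith
    · change p.2 ≤ M
      linarith
  obtain ⟨p, hp, hmin⟩ := hcomp.exists_isMinOn ⟨0, h0, le_refl M⟩
    (continuous_coneObjective γ y).continuousOn
  refine ⟨p, hp.1, fun q hq => ?_⟩
  by_cases hqM : coneObjective γ y q ≤ M
  · exact hmin ⟨hq, hqM⟩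
  · exact (show coneObjective γ y p ≤ M from hp.2).trans (not_le.1 hqM).le

theorem nonneg_of_forall_quadratic_nonneg {A C : ℝ} (hC : 0 ≤ C)
    (h : ∀ ε, 0 ≤ ε → ε ≤ 1 → 0 ≤ ε * A + ε ^ 2 * C) : 0 ≤ A := by
  by_contra hA
  push Not at hA
  have hd : 0 < C - A := by linarith
  -- This `ε` lies in `[0, 1]` and gives the negative value `A ^ 3 / (C - A) ^ 2`.
  have h1 := h (-A / (C - A)) (div_nonneg (by linarith) hd.le) ((div_le_one hd).2 (by linarith))
  have h2 : -A / (C - A) * A + (-A / (C - A)) ^ 2 * C = A ^ 3 / (C - A) ^ 2 := by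
    field_simp
    ring
  rw [h2] at h1
  have h3 : A ^ 3 < 0 := by nlinarith [sq_nonneg A, mul_pos_of_neg_of_neg hA hA]
  exact absurd h1 (not_le.2 (div_neg_of_neg_of_pos h3 (pow_pos hd 2)))

theorem coneObjective_add_smul (γ y : Fin n → ℝ) (p q : (Fin n → ℝ) × ℝ) (ε : ℝ) :
    coneObjective γ y (p + ε • q) = coneObjective γ y p +
      (ε * (∑ i, γ i * (p.1 i - y i) * q.1 i + q.2) + ε ^ 2 * (1 / 2 * ∑ i, γ i * q.1 i ^ 2)) := by
  have e : ∑ i, γ i * ((p + ε • q).1 i - y i) ^ 2 = ∑ i, γ i * (p.1 i - y i) ^ 2 +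
      2 * ε * ∑ i, γ i * (p.1 i - y i) * q.1 i + ε ^ 2 * ∑ i, γ i * q.1 i ^ 2 := by
    simp only [Finset.mul_sum, ← Finset.sum_add_distrib]
    refine Finset.sum_congr rfl fun i _ => ?_
    simp only [Prod.fst_add, Prod.smul_fst, Pi.add_apply, Pi.smul_apply, smul_eq_mul]
    ring
  rw [coneObjective, coneObjective, e]
  simp only [Prod.snd_add, Prod.smul_snd, smul_eq_mul]
  ring

/-- A dual feasible point whose dual value is approached by primal values of `n` atoms. -/
theorem exists_dual_certificate [Nonempty S] (v : S → Fin n → ℝ) {γ : Fin n → ℝ}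
    (hγ : ∀ i, 0 < γ i) (y : Fin n → ℝ) :
    ∃ l : Fin n → ℝ, (∀ s, |∑ i, l i * v s i| ≤ 1) ∧
      ∀ δ > 0, ∃ (α : Fin n → ℝ) (w : Fin n → S),
        1 / 2 * ∑ i, γ i * (∑ j, α j * v (w j) i - y i) ^ 2 + l1Norm α <
          -∑ i, (-l) i * ((-l) i / (2 * γ i) + y i) + δ := by
  obtain ⟨p, hp, hmin⟩ := exists_isMinOn_closure_featureCone v hγ y
  have hquad : ∀ q : (Fin n → ℝ) × ℝ, 0 ≤ 1 / 2 * ∑ i, γ i * q.1 i ^ 2 := fun q =>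
    mul_nonneg (by norm_num) (Finset.sum_nonneg fun i _ => mul_nonneg (hγ i).le (sq_nonneg _))
  -- First-order condition: the directional derivative at `p` is nonnegative along every admissible
  -- direction.
  have hdir : ∀ q : (Fin n → ℝ) × ℝ,
      (∀ ε : ℝ, 0 ≤ ε → ε ≤ 1 → p + ε • q ∈ closure (featureCone v)) →
      0 ≤ ∑ i, γ i * (p.1 i - y i) * q.1 i + q.2 := by
    intro q hq
    refine nonneg_of_forall_quadratic_nonneg (hquad q) fun ε h0 h1 => ?_
    have := hmin _ (hq ε h0 h1)
    rw [coneObjective_add_smul] at this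
    linarith
  have hcone : ∀ q ∈ closure (featureCone v), 0 ≤ ∑ i, γ i * (p.1 i - y i) * q.1 i + q.2 :=
    fun q hq => hdir q fun ε h0 _ =>
      add_mem_closure_featureCone hp (smul_mem_closure_featureCone h0 hq)
  -- Complementary slackness: both `p` and `-p` are admissible, since scaling by `1 - ε` stays in
  -- the cone.
  have hD : ∑ i, γ i * (p.1 i - y i) * p.1 i + p.2 = 0 := by
    refine le_antisymm ?_ (hcone p hp)
    have := hdir (-p) fun ε _ h1 => by
      have e : p + ε • -p = (1 - ε) • p := by module
      rw [e]
      exact smul_mem_closure_featureCone (sub_nonneg.2 h1) hp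
    simp only [Prod.fst_neg, Prod.snd_neg, Pi.neg_apply, mul_neg, Finset.sum_neg_distrib] at this
    linarith
  have hvalue : coneObjective γ y p =
      -∑ i, (-fun i => γ i * (y i - p.1 i)) i *
        ((-fun i => γ i * (y i - p.1 i)) i / (2 * γ i) + y i) := by
    rw [coneObjective, eq_neg_iff_add_eq_zero.2 ((add_comm _ _).trans hD), Finset.mul_sum,
      ← sub_eq_add_neg, ← Finset.sum_sub_distrib, ← Finset.sum_neg_distrib]
    refine Finset.sum_congr rfl fun i _ => ?_
    have := (hγ i).ne'
    simp only [Pi.neg_apply]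
    field_simp
    ring
  -- The dual point is the negative gradient of the fidelity at `p`. Testing the cone with `(± v s,
  -- 1)` gives feasibility.
  refine ⟨fun i => γ i * (y i - p.1 i), fun s => abs_le.2 ?_, fun δ hδ => ?_⟩
  · have hmem : ∀ c : ℝ, |c| ≤ 1 → (c • v s, (1 : ℝ)) ∈ closure (featureCone v) := fun c hc =>
      subset_closure ⟨Finsupp.single s c, by simp, by simpa [finsuppL1_single] using hc⟩
    have h1 := hcone _ (hmem 1 (by simp))
    have h2 := hcone _ (hmem (-1) (by simp))
    have e : ∑ i, γ i * (y i - p.1 i) * v s i = -∑ i, γ i * (p.1 i - y i) * v s i := by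
      rw [← Finset.sum_neg_distrib]
      exact Finset.sum_congr rfl fun i _ => by ring
    simp only [one_smul, neg_smul, Pi.neg_apply, mul_neg, Finset.sum_neg_distrib] at h1 h2
    rw [e]
    constructor <;> linarith
  · rw [← hvalue]
    -- `p` lies only in the closure, so a genuine combination is taken nearby, at the cost of `δ`;
    -- the dimension `n` then bounds the number of atoms.
    obtain ⟨q, hq, a, ha, hat⟩ := mem_closure_iff.1 hp _
      (isOpen_Iio.preimage (continuous_coneObjective γ y))
      (show coneObjective γ y p < coneObjective γ y p + δ by linarith)
    obtain ⟨b, hb, hbv, hbl⟩ := exists_card_support_le v a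
    obtain ⟨α, w, hαv, hαl⟩ := exists_fin_combination v b (n := n) (by simpa using hb)
    refine ⟨α, w, lt_of_le_of_lt ?_ hq⟩
    have e : ∀ i, ∑ j, α j * v (w j) i = q.1 i := by
      intro i
      rw [← ha, ← hbv, ← hαv]
      simp
    rw [coneObjective, hαl]
    simp only [e]
    linarith

end FiniteDuality

/-! ### The cycle of inequalities -/

section Duality

variable {X Ω : Type*} [TopologicalSpace X] [TopologicalSpace Ω]
  [MeasurableSpace X] [MeasurableSpace Ω] {n : ℕ}

theorem featureMap_atomic [MeasurableSingletonClass Ω] (φ : C₀(X × Ω, ℝ)) (α : Fin n → ℝ)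
    (w : Fin n → Ω) (s : X) : featureMap φ (atomic α w) s = ∑ j, α j * φ (s, w j) :=
  pairing_atomic α w _

theorem adjointMap_atomic [MeasurableSingletonClass X] (φ : C₀(X × Ω, ℝ)) (l : Fin n → ℝ)
    (x : Fin n → X) (w : Ω) : adjointMap φ (atomic l x) w = ∑ i, l i * φ (x i, w) :=
  pairing_atomic l x _

/-- Fubini, which for an atomic first measure is just linearity of the integral over a finite sum.
-/
theorem pairing_featureMap_atomic [MeasurableSingletonClass X] [OpensMeasurableSpace Ω]
    (φ : C₀(X × Ω, ℝ)) (l : Fin n → ℝ) (x : Fin n → X) (μ : SignedMeasure Ω) :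
    pairing (atomic l x) (featureMap φ μ) = pairing μ (adjointMap φ (atomic l x)) := by
  have e : adjointMap φ (atomic l x) = fun w => ∑ i, l i * φ (x i, w) :=
    funext (adjointMap_atomic φ l x)
  rw [e, pairing_finsetSum, pairing_atomic]
  · rfl
  · exact fun i _ => integrable_of_continuous_bounded μ (by fun_prop)
      fun w => φ.toBCF.norm_coe_le_norm (x i, w)

theorem fidelity_featureMap_atomic [MeasurableSingletonClass X] [MeasurableSingletonClass Ω]
    (φ : C₀(X × Ω, ℝ)) (x : Fin n → X) (y : X → ℝ) {γ : Fin n → ℝ} (hγ : ∀ i, 0 ≤ γ i)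
    (α : Fin n → ℝ) (w : Fin n → Ω) :
    fidelity (dataMeasure γ x) y (featureMap φ (atomic α w)) = finFidelity φ x γ y α w := by
  simp only [fidelity_dataMeasure hγ, featureMap_atomic, finFidelity]

theorem ermObjective_atomic_le [MeasurableSingletonClass X] [MeasurableSingletonClass Ω]
    (φ : C₀(X × Ω, ℝ)) (x : Fin n → X) (y : X → ℝ) {γ : Fin n → ℝ} (hγ : ∀ i, 0 ≤ γ i)
    (p : (Fin n → ℝ) × (Fin n → Ω)) :
    ermObjective φ (dataMeasure γ x) y (atomic p.1 p.2) ≤ finObjective φ x γ y p := by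
  rw [ermObjective, finObjective, fidelity_featureMap_atomic φ x y hγ]
  exact add_le_add le_rfl (tvNorm_atomic_le _ _)

/-- Completing the square: the unconstrained maximiser takes the values `y (x i) + l i / γ i`. -/
theorem pairing_sub_fidelity [MeasurableSingletonClass X] (x : Fin n → X) (y : X → ℝ)
    {γ : Fin n → ℝ} (hγ : ∀ i, 0 < γ i) (l : Fin n → ℝ) (f : X → ℝ) :
    pairing (atomic l x) f - fidelity (dataMeasure γ x) y f =
      finFidelityConj x γ y l -
        1 / 2 * ∑ i, γ i * (f (x i) - (y (x i) + l i / γ i)) ^ 2 := by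
  rw [fidelity_dataMeasure fun i => (hγ i).le, pairing_atomic, finFidelityConj]
  simp only [Finset.mul_sum, ← Finset.sum_sub_distrib]
  refine Finset.sum_congr rfl fun i _ => ?_
  have := (hγ i).ne'
  field_simp
  ring

theorem fidelityConj_atomic_le [MeasurableSingletonClass X] (φ : C₀(X × Ω, ℝ)) (x : Fin n → X)
    (y : X → ℝ) {γ : Fin n → ℝ} (hγ : ∀ i, 0 < γ i) (l : Fin n → ℝ) :
    fidelityConj φ (dataMeasure γ x) y (atomic l x) ≤ finFidelityConj x γ y l := by
  refine iSup₂_le fun f _ => ?_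
  rw [pairing_sub_fidelity x y hγ, EReal.coe_le_coe_iff]
  refine sub_le_self _ (mul_nonneg (by norm_num) (Finset.sum_nonneg fun i _ => ?_))
  exact mul_nonneg (hγ i).le (sq_nonneg _)

theorem integral_sq_sub_eq_norm_sq {S : Type*} [MeasurableSpace S] {ν : Measure S}
    {f g : S → ℝ} (hg : MemLp g 2 ν) {h : Lp ℝ 2 ν} (hf : h =ᵐ[ν] f) :
    ∫ s, (f s - g s) ^ 2 ∂ν = ‖h - hg.toLp g‖ ^ 2 := by
  rw [← real_inner_self_eq_norm_sq, L2.inner_def]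
  refine integral_congr_ae ?_
  filter_upwards [hf, hg.coeFn_toLp, Lp.coeFn_sub h (hg.toLp g)] with s h1 h2 h3
  rw [h3, Pi.sub_apply, h1, h2]
  simp [sq]

theorem exists_fidelity_lt_of_denseInL2 {φ : C₀(X × Ω, ℝ)} {ν : Measure X}
    (hd : DenseInL2 φ ν) {g : X → ℝ} (hg : MemLp g 2 ν) {δ : ℝ} (hδ : 0 < δ) :
    ∃ f ∈ functionSpace φ, fidelity ν g f < δ := by
  obtain ⟨h, ⟨f, hf, hhf⟩, hdist⟩ := hd.exists_dist_lt (hg.toLp g) (Real.sqrt_pos.2 hδ)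
  refine ⟨f, hf, ?_⟩
  rw [fidelity, integral_sq_sub_eq_norm_sq hg hhf]
  rw [dist_comm, dist_eq_norm] at hdist
  have := Real.lt_sqrt (norm_nonneg _) |>.1 hdist
  linarith [sq_nonneg ‖h - hg.toLp g‖]

theorem memLp_dataMeasure [Finite X] [MeasurableSingletonClass X] (γ : Fin n → ℝ) (x : Fin n → X)
    (g : X → ℝ) : MemLp g 2 (dataMeasure γ x) := by
  have : IsFiniteMeasure (dataMeasure γ x) := by
    refine ⟨?_⟩
    simp [dataMeasure, ENNReal.sum_lt_top]
  exact MemLp.of_discrete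

theorem fidelityConj_atomic [MeasurableSingletonClass X] {φ : C₀(X × Ω, ℝ)} (x : Fin n ≃ X)
    {y : X → ℝ} {γ : Fin n → ℝ} (hγ : ∀ i, 0 < γ i) (hd : DenseInL2 φ (dataMeasure γ x))
    (l : Fin n → ℝ) :
    fidelityConj φ (dataMeasure γ x) y (atomic l x) = finFidelityConj x γ y l := by
  have : Finite X := Finite.of_equiv _ x
  refine le_antisymm (fidelityConj_atomic_le φ x y hγ l) ?_
  refine EReal.ge_of_forall_gt_iff_ge.1 fun c hc => ?_
  rw [EReal.coe_lt_coe_iff] at hc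
  -- The unconstrained maximiser; density approximates it in `L²`, so the lost square can be made
  -- smaller than any gap.
  set g : X → ℝ := fun s => y s + l (x.symm s) / γ (x.symm s)
  obtain ⟨f, hf, hlt⟩ := exists_fidelity_lt_of_denseInL2 hd (memLp_dataMeasure γ x g)
    (sub_pos.2 hc)
  refine le_iSup₂_of_le f hf ?_
  rw [EReal.coe_le_coe_iff, pairing_sub_fidelity x y hγ]
  rw [fidelity_dataMeasure fun i => (hγ i).le] at hlt
  simp only [g, Equiv.symm_apply_apply] at hlt
  linarith

theorem regConj_adjointMap_atomic [MeasurableSingletonClass X] [MeasurableSingletonClass Ω]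
    (φ : C₀(X × Ω, ℝ)) (x : Fin n → X) (l : Fin n → ℝ) :
    regConj (adjointMap φ (atomic l x)) = finRegConj φ x l := by
  rw [finRegConj]
  split_ifs with h
  · exact regConj_eq_zero fun w => by rw [adjointMap_atomic]; exact abs_le.2 (h w)
  · push Not at h
    obtain ⟨w, hw⟩ := h
    refine regConj_eq_top (s := w) ?_
    rw [adjointMap_atomic]
    by_contra hle
    obtain ⟨h1, h2⟩ := abs_le.1 (not_lt.1 hle)
    exact absurd h2 (not_le.2 (hw h1))

/-- Fenchel–Young for both conjugates; the two pairings cancel by adjointness. -/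
theorem dualValue_le_primalValue [MeasurableSingletonClass X] [OpensMeasurableSpace Ω]
    (φ : C₀(X × Ω, ℝ)) (x : Fin n ≃ X) (ν : Measure X) (y : X → ℝ) :
    dualValue φ ν y ≤ primalValue φ ν y := by
  refine iSup_le fun ρ => le_iInf fun μ => ?_
  obtain ⟨l, rfl, -⟩ := existsUnique_eq_atomic x ρ
  have h1 : ((pairing (-atomic l x) (featureMap φ μ) - fidelity ν y (featureMap φ μ) : ℝ) : EReal)
      ≤ fidelityConj φ ν y (-atomic l x) :=
    le_iSup₂_of_le (featureMap φ μ) ⟨μ, rfl⟩ le_rfl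
  have h2 : ((pairing μ (adjointMap φ (atomic l x)) - tvNorm μ : ℝ) : EReal)
      ≤ regConj (adjointMap φ (atomic l x)) :=
    le_iSup (fun μ => ((pairing μ (adjointMap φ (atomic l x)) - tvNorm μ : ℝ) : EReal)) μ
  refine (EReal.sub_le_sub (EReal.neg_le_neg_iff.2 h1) h2).trans ?_
  rw [← EReal.coe_neg, ← EReal.coe_sub, EReal.coe_le_coe_iff, pairing_neg,
    pairing_featureMap_atomic, ermObjective]
  linarith

theorem finDualValue_le_dualValue [MeasurableSingletonClass X] [MeasurableSingletonClass Ω]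
    (φ : C₀(X × Ω, ℝ)) (x : Fin n → X) (y : X → ℝ) {γ : Fin n → ℝ} (hγ : ∀ i, 0 < γ i) :
    (⨆ l : Fin n → ℝ, (-(finFidelityConj x γ y (-l) : EReal) - finRegConj φ x l)) ≤
      dualValue φ (dataMeasure γ x) y := by
  refine iSup_le fun l => le_iSup_of_le (atomic l x) ?_
  rw [regConj_adjointMap_atomic, neg_atomic]
  exact EReal.sub_le_sub (EReal.neg_le_neg_iff.2 (fidelityConj_atomic_le φ x y hγ (-l))) le_rfl

theorem primalValue_le_finPrimalValue [MeasurableSingletonClass X] [MeasurableSingletonClass Ω]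
    (φ : C₀(X × Ω, ℝ)) (x : Fin n → X) (y : X → ℝ) {γ : Fin n → ℝ} (hγ : ∀ i, 0 < γ i) :
    primalValue φ (dataMeasure γ x) y ≤
      ⨅ p : (Fin n → ℝ) × (Fin n → Ω), (finObjective φ x γ y p : EReal) :=
  le_iInf fun p => iInf_le_of_le (atomic p.1 p.2)
    (EReal.coe_le_coe_iff.2 (ermObjective_atomic_le φ x y (fun i => (hγ i).le) p))

theorem finPrimalValue_le_finDualValue [Nonempty Ω] (φ : C₀(X × Ω, ℝ)) (x : Fin n → X)
    (y : X → ℝ) {γ : Fin n → ℝ} (hγ : ∀ i, 0 < γ i) :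
    (⨅ p : (Fin n → ℝ) × (Fin n → Ω), (finObjective φ x γ y p : EReal)) ≤
      ⨆ l : Fin n → ℝ, (-(finFidelityConj x γ y (-l) : EReal) - finRegConj φ x l) := by
  obtain ⟨l, hl, happrox⟩ := exists_dual_certificate (fun (w : Ω) i => φ (x i, w)) hγ
    (fun i => y (x i))
  refine le_iSup_of_le l ?_
  rw [finRegConj, if_pos fun w => abs_le.1 (hl w), sub_zero, ← EReal.coe_neg]
  refine EReal.le_of_forall_lt_iff_le.1 fun c hc => ?_
  rw [EReal.coe_lt_coe_iff] at hc
  obtain ⟨α, w, hlt⟩ := happrox _ (sub_pos.2 hc)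
  refine iInf_le_of_le (α, w) (EReal.coe_le_coe_iff.2 ?_)
  rw [finObjective, finFidelity]
  rw [finFidelityConj] at hlt
  linarith

end Duality

end IntegralRKBS


theorem mainTheorem10 {d D n : ℕ}
    (X : Set (EuclideanSpace ℝ (Fin d))) (Ω : Set (EuclideanSpace ℝ (Fin D)))
    (hΩ : IsClosed Ω) (hΩne : Ω.Nonempty)
    (φ : C₀(X × Ω, ℝ)) (x : Fin n ≃ X) (y : X → ℝ)
    (γ : Fin n → ℝ) (hγ : ∀ i, 0 < γ i) (hγsum : ∑ i, γ i = 1) :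
    -- the finite primal problem rewrites the primal problem over measures
    (∀ (α : Fin n → ℝ) (w : Fin n → Ω),
      IntegralRKBS.fidelity (IntegralRKBS.dataMeasure γ x) y
          (IntegralRKBS.featureMap φ (IntegralRKBS.atomic α w)) =
        IntegralRKBS.finFidelity φ x γ y α w ∧
      IntegralRKBS.tvNorm (IntegralRKBS.atomic α w) ≤ IntegralRKBS.l1Norm α ∧
      (Function.Injective w →
        IntegralRKBS.tvNorm (IntegralRKBS.atomic α w) = IntegralRKBS.l1Norm α) ∧
      (IsMinOn (IntegralRKBS.finObjective φ x γ y) Set.univ (α, w) →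
        IsMinOn (IntegralRKBS.ermObjective φ (IntegralRKBS.dataMeasure γ x) y) Set.univ
          (IntegralRKBS.atomic α w))) ∧
    IntegralRKBS.primalValue φ (IntegralRKBS.dataMeasure γ x) y =
      (⨅ p : (Fin n → ℝ) × (Fin n → Ω), (IntegralRKBS.finObjective φ x γ y p : EReal)) ∧
    -- the finite dual problem rewrites the dual problem over measures
    (∀ ρ : SignedMeasure X, ∃! l : Fin n → ℝ, ρ = IntegralRKBS.atomic l x) ∧
    (IntegralRKBS.DenseInL2 φ (IntegralRKBS.dataMeasure γ x) →
      ∀ l : Fin n → ℝ,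
        IntegralRKBS.fidelityConj φ (IntegralRKBS.dataMeasure γ x) y
          (IntegralRKBS.atomic l x) = (IntegralRKBS.finFidelityConj x γ y l : EReal)) ∧
    (∀ l : Fin n → ℝ,
      IntegralRKBS.regConj (IntegralRKBS.adjointMap φ (IntegralRKBS.atomic l x)) =
        IntegralRKBS.finRegConj φ x l) ∧
    IntegralRKBS.dualValue φ (IntegralRKBS.dataMeasure γ x) y =
      (⨆ l : Fin n → ℝ,
        (-(IntegralRKBS.finFidelityConj x γ y (-l) : EReal) - IntegralRKBS.finRegConj φ x l)) ∧
    -- strong duality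
    (⨅ p : (Fin n → ℝ) × (Fin n → Ω), (IntegralRKBS.finObjective φ x γ y p : EReal)) =
      (⨆ l : Fin n → ℝ,
        (-(IntegralRKBS.finFidelityConj x γ y (-l) : EReal) - IntegralRKBS.finRegConj φ x l)) := by
  have hΩne' : Nonempty Ω := hΩne.to_subtype
  have h1 := IntegralRKBS.primalValue_le_finPrimalValue φ x y hγ
  have h2 := IntegralRKBS.finPrimalValue_le_finDualValue φ x y hγ
  have h3 := IntegralRKBS.finDualValue_le_dualValue φ x y hγ
  have h4 := IntegralRKBS.dualValue_le_primalValue φ x (IntegralRKBS.dataMeasure γ x) y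
  have hprimal := le_antisymm h1 (h2.trans (h3.trans h4))
  refine ⟨fun α w => ⟨IntegralRKBS.fidelity_featureMap_atomic φ x y (fun i => (hγ i).le) α w,
    IntegralRKBS.tvNorm_atomic_le α w, fun hw => IntegralRKBS.tvNorm_atomic α hw,
    fun hmin μ _ => ?_⟩, hprimal, IntegralRKBS.existsUnique_eq_atomic x,
    fun hd l => IntegralRKBS.fidelityConj_atomic x hγ hd l,
    fun l => IntegralRKBS.regConj_adjointMap_atomic φ x l,
    le_antisymm (h4.trans (h1.trans h2)) h3, le_antisymm h2 (h3.trans (h4.trans h1))⟩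
  -- Passing to the atomic measure does not raise the objective, and the two infima agree, so
  -- minimality transfers.
  refine (IntegralRKBS.ermObjective_atomic_le φ x y (fun i => (hγ i).le) (α, w)).trans ?_
  rw [← EReal.coe_le_coe_iff]
  calc (IntegralRKBS.finObjective φ x γ y (α, w) : EReal)
      ≤ ⨅ p : (Fin n → ℝ) × (Fin n → Ω), (IntegralRKBS.finObjective φ x γ y p : EReal) :=
        le_iInf fun p => EReal.coe_le_coe_iff.2 (hmin (Set.mem_univ p))
    _ = IntegralRKBS.primalValue φ (IntegralRKBS.dataMeasure γ x) y := hprimal.symm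
    _ ≤ _ := iInf_le _ μ
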